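/- Let $n$ be a number of modes, let $\mathcal H_n=L^2(\mathbb R^n)$ be the Hilbert space of $n$ harmonic oscillators with quadratures $r=(x_1,p_1,\dots,x_n,p_n)^{\intercal}$, $[r_i,r_j]=i\Omega_{ij}$, $\Omega=\begin{pmatrix}0&1\\-1&0\end{pmatrix}^{\oplus n}$, and let $D(\xi)=e^{i\xi^{\intercal}\Omega r}$, $\xi\in\mathbb R^{2n}$, be the displacement operators. For a trace-class operator $T$ on $\mathcal H_n$ put $\chi_T(\xi)=\operatorname{Tr}[T D(\xi)]$. A bosonic channel is a completely positive, trace-preserving linear map $\Phi$ on the trace-class operators on $\mathcal H_n$; it is called linear if there are a real $2n\times 2n$ matrix $X$ and a function $f:\mathbb R^{2n}\to\mathbb C$ such that $\chi_{\Phi(T)}(\xi)=\chi_T(X\xi)f(\xi)$ for all trace-class $T$ and all $\xi$. A linear map $\Phi$ on the trace-class operators is called Gaussian dilatable if there are an integer $m\ge 0$, a state (density operator) $\sigma$ on the space $\mathcal H_m$ of an ancilla $E$ with $m$ modes, not required to have finite energy, and a Gaussian unitary $U$ on $\mathcal H_n\otimes\mathcal H_m$ such that $\Phi(\rho)=\operatorname{Tr}_E[U(\rho\otimes\sigma)U^\dagger]$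 for all states $\rho$ on $\mathcal H_n$. Here a Gaussian unitary is a product $(D(s')\otimes D(t'))V$ with $s'\in\mathbb R^{2n}$, $t'\in\mathbb R^{2m}$ and $V$ a symplectic unitary, i.e. a unitary $V$ for which there is a real symplectic $2(n+m)\times 2(n+m)$ matrix $S$ with $V^\dagger D(\zeta)V=D(S\zeta)$ for all $\zeta\in\mathbb R^{2n}\oplus\mathbb R^{2m}$, where $D(\xi\oplus\eta)=D(\xi)\otimes D(\eta)$. Then, for every $s\in\mathbb R^{2n}$ with $s\neq 0$, the binary displacement channel $$\mathcal E_s(\rho)=\tfrac12 D(-s)\rho D(s)+\tfrac12 D(s)\rho D(-s)$$ is a linear bosonic channel, but it is not Gaussian dilatable. -/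

import Mathlib

open scoped ComplexOrder InnerProductSpace TensorProduct

noncomputable section

namespace Bosonic

/-! ### Trace-class operators, trace, density operators, partial trace -/

section Hilbert

universe u v

/-- A positive bounded operator with finite trace: the sum of its diagonal matrix elements
converges in some orthonormal (Hilbert) basis. -/
def IsPositiveFiniteTrace {H : Type u} [NormedAddCommGroup H] [InnerProductSpace ℂ H]
    (A : H →L[ℂ] H) : Prop :=
  A.IsPositive ∧ ∃ (ι : Type u) (b : HilbertBasis ι ℂ H),
    Summable fun i => (⟪b i, A (b i)⟫_ℂ).re

/-- The space `𝒯(H)` of trace-class operators on `H`: the complex linear combinations of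
positive operators with finite trace. -/
def traceClass (H : Type u) [NormedAddCommGroup H] [InnerProductSpace ℂ H] :
    Submodule ℂ (H →L[ℂ] H) :=
  Submodule.span ℂ {A | IsPositiveFiniteTrace A}

/-- The trace `∑ᵢ ⟨bᵢ, T bᵢ⟩`, computed in a fixed orthonormal basis; for trace-class `T` the sum
converges absolutely and does not depend on the basis. -/
def trace {H : Type u} [NormedAddCommGroup H] [InnerProductSpace ℂ H] [CompleteSpace H]
    (T : H →L[ℂ] H) : ℂ :=
  ∑' i : (exists_hilbertBasis ℂ H).choose,
    ⟪(exists_hilbertBasis ℂ H).choose_spec.choose i,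
      T ((exists_hilbertBasis ℂ H).choose_spec.choose i)⟫_ℂ

/-- Density operators (quantum states): positive trace-class operators of unit trace. -/
def IsDensityOperator {H : Type u} [NormedAddCommGroup H] [InnerProductSpace ℂ H]
    [CompleteSpace H] (ρ : traceClass H) : Prop :=
  (ρ : H →L[ℂ] H).IsPositive ∧ trace (ρ : H →L[ℂ] H) = 1

/-- The Hilbert-space tensor product: the completion of the algebraic tensor product for the
norm of `⟪a ⊗ b, a' ⊗ b'⟫ = ⟪a, a'⟫ ⟪b, b'⟫`. -/
abbrev HilbertTensor (H : Type u) (K : Type v) [NormedAddCommGroup H] [InnerProductSpace ℂ H]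
    [NormedAddCommGroup K] [InnerProductSpace ℂ K] : Type (max u v) :=
  UniformSpace.Completion (H ⊗[ℂ] K)

/-- The tensor product `A ⊗ B` of bounded operators on the Hilbert-space tensor product. -/
def opTensor {H : Type u} {K : Type v} [NormedAddCommGroup H] [InnerProductSpace ℂ H]
    [NormedAddCommGroup K] [InnerProductSpace ℂ K] (A : H →L[ℂ] H) (B : K →L[ℂ] K) :
    HilbertTensor H K →L[ℂ] HilbertTensor H K :=
  (TensorProduct.mapL A B).completion

theorem opTensor_coe_tmul {H : Type u} {K : Type v} [NormedAddCommGroup H]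
    [InnerProductSpace ℂ H] [NormedAddCommGroup K] [InnerProductSpace ℂ K]
    (A : H →L[ℂ] H) (B : K →L[ℂ] K) (x : H) (y : K) :
    opTensor A B ((x ⊗ₜ[ℂ] y : H ⊗[ℂ] K) : HilbertTensor H K)
      = ((A x ⊗ₜ[ℂ] B y : H ⊗[ℂ] K) : HilbertTensor H K) := by
  simp [opTensor]

/-- `τ` is the partial trace `Tr_K T` of the trace-class operator `T` on `H ⊗ K`: the (unique)
trace-class operator on `H` with `Tr[τ B] = Tr[T (B ⊗ 1)]` for all bounded `B` on `H`. -/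
def IsPartialTrace {H : Type u} {K : Type v} [NormedAddCommGroup H] [InnerProductSpace ℂ H]
    [CompleteSpace H] [NormedAddCommGroup K] [InnerProductSpace ℂ K]
    (T : HilbertTensor H K →L[ℂ] HilbertTensor H K) (τ : traceClass H) : Prop :=
  ∀ B : H →L[ℂ] H, trace ((τ : H →L[ℂ] H) ∘L B) = trace (T ∘L opTensor B 1)

/-- Complete positivity of a linear map `Φ` on trace-class operators: for each `k`, applying `Φ`
entrywise maps positive `k × k` block operators (on `H^k = H ⊗ ℂ^k`) to positive ones. -/
def IsCompletelyPositive {H : Type u} [NormedAddCommGroup H] [InnerProductSpace ℂ H]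
    (Φ : traceClass H →ₗ[ℂ] traceClass H) : Prop :=
  ∀ (k : ℕ) (T : Fin k → Fin k → traceClass H),
    (∀ v : Fin k → H, 0 ≤ ∑ i, ∑ j, ⟪v i, (T i j : H →L[ℂ] H) (v j)⟫_ℂ) →
    ∀ v : Fin k → H, 0 ≤ ∑ i, ∑ j, ⟪v i, (Φ (T i j) : H →L[ℂ] H) (v j)⟫_ℂ

/-- Trace preservation. -/
def IsTracePreserving {H : Type u} [NormedAddCommGroup H] [InnerProductSpace ℂ H]
    [CompleteSpace H] (Φ : traceClass H →ₗ[ℂ] traceClass H) : Prop :=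
  ∀ T : traceClass H, trace (Φ T : H →L[ℂ] H) = trace (T : H →L[ℂ] H)

theorem isPositiveFiniteTrace_conj {H : Type u} [NormedAddCommGroup H] [InnerProductSpace ℂ H]
    [CompleteSpace H] {U A : H →L[ℂ] H} (hU : U ∈ unitary (H →L[ℂ] H))
    (hA : IsPositiveFiniteTrace A) : IsPositiveFiniteTrace (U ∘L A ∘L star U) := by
  obtain ⟨hp, ι, b, hs⟩ := hA
  refine ⟨hp.conj_adjoint U, ι,
    HilbertBasis.ofRepr ((Unitary.linearIsometryEquiv ⟨U, hU⟩).symm.trans b.repr), ?_⟩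
  have hb : ∀ i, (HilbertBasis.ofRepr
      ((Unitary.linearIsometryEquiv ⟨U, hU⟩).symm.trans b.repr)) i = U (b i) := by
    intro i
    classical
    rw [← HilbertBasis.repr_symm_single, ← HilbertBasis.repr_symm_single]
    rfl
  have h1 : ∀ x, (star U) (U x) = x := fun x => by
    have := (Unitary.mem_iff.mp hU).1
    exact congrArg (fun f : H →L[ℂ] H => f x) this
  refine hs.congr fun i => ?_
  rw [hb]
  simp only [ContinuousLinearMap.comp_apply, h1]
  rw [← ContinuousLinearMap.adjoint_inner_right, ← ContinuousLinearMap.star_eq_adjoint, h1]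

theorem conj_mem_traceClass {H : Type u} [NormedAddCommGroup H] [InnerProductSpace ℂ H]
    [CompleteSpace H] {U T : H →L[ℂ] H} (hU : U ∈ unitary (H →L[ℂ] H))
    (hT : T ∈ traceClass H) : U ∘L T ∘L star U ∈ traceClass H := by
  induction hT using Submodule.span_induction with
  | mem x h => exact Submodule.subset_span (isPositiveFiniteTrace_conj hU h)
  | zero => simp
  | add x y _ _ hx hy =>
    simpa only [ContinuousLinearMap.add_comp, ContinuousLinearMap.comp_add] using add_mem hx hy
  | smul a x _ hx =>
    simpa only [ContinuousLinearMap.smul_comp, ContinuousLinearMap.comp_smul] using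
      Submodule.smul_mem _ a hx

end Hilbert

/-! ### `n`-mode systems and displacement operators -/

section Modes

open MeasureTheory

/-- The Hilbert space `L²(ℝⁿ)` of `n` harmonic oscillators (position representation). -/
abbrev ModeSpace (n : ℕ) : Type :=
  Lp (α := Fin n → ℝ) ℂ 2 volume

/-- The phase space `ℝ²ⁿ`: `ξ (0, j)` and `ξ (1, j)` are the components of `ξ` along the
quadratures `x_j` and `p_j`. -/
abbrev PhaseSpace (n : ℕ) : Type := Fin 2 × Fin n → ℝ

/-- The symplectic form `Ω = [[0, 1], [-1, 0]]^{⊕ n}`. -/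
def Ω (n : ℕ) : Matrix (Fin 2 × Fin n) (Fin 2 × Fin n) ℝ :=
  Matrix.blockDiagonal fun _ : Fin n => !![0, 1; -1, 0]

/-- The translation vector in position space of the displacement by `ξ`. -/
def shift {n : ℕ} (ξ : PhaseSpace n) : Fin n → ℝ := fun j => ξ (0, j)

/-- The phase function of the displacement by `ξ`. -/
def phase {n : ℕ} (ξ : PhaseSpace n) (x : Fin n → ℝ) : ℝ :=
  -(∑ j, ξ (1, j) * x j) - (∑ j, ξ (0, j) * ξ (1, j)) / 2

theorem memLp_displaced {n : ℕ} (ξ : PhaseSpace n) (ψ : ModeSpace n) :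
    MemLp (fun x => Complex.exp (Complex.I * phase ξ x) * ψ (x + shift ξ)) 2 volume := by
  have h := (Lp.memLp ψ).comp_measurePreserving (measurePreserving_add_right volume (shift ξ))
  refine h.congr_norm ?_ ?_
  · refine AEStronglyMeasurable.mul ?_ h.1
    refine Continuous.aestronglyMeasurable ?_
    unfold phase
    fun_prop
  · refine Filter.Eventually.of_forall fun x => ?_
    rw [norm_mul, mul_comm Complex.I, Complex.norm_exp_ofReal_mul_I, one_mul]
    rfl

theorem ae_shift {n : ℕ} (a : Fin n → ℝ) {p : (Fin n → ℝ) → Prop} (h : ∀ᵐ x, p x) :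
    ∀ᵐ x, p (x + a) :=
  (measurePreserving_add_right volume a).quasiMeasurePreserving.ae h

/-- The linear isometry underlying the displacement operator `D(ξ)`. -/
def displacementIsometry {n : ℕ} (ξ : PhaseSpace n) : ModeSpace n →ₗᵢ[ℂ] ModeSpace n :=
    { toFun := fun ψ => (memLp_displaced ξ ψ).toLp _
      map_add' := fun ψ φ => by
        rw [← MemLp.toLp_add]
        refine MemLp.toLp_congr _ _ ?_
        filter_upwards [ae_shift (shift ξ) (Lp.coeFn_add ψ φ)] with x hx
        simp only [Pi.add_apply] at hx ⊢
        rw [hx, mul_add]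
      map_smul' := fun c ψ => by
        rw [RingHom.id_apply, ← MemLp.toLp_const_smul]
        refine MemLp.toLp_congr _ _ ?_
        filter_upwards [ae_shift (shift ξ) (Lp.coeFn_smul c ψ)] with x hx
        simp only [Pi.smul_apply, smul_eq_mul] at hx ⊢
        rw [hx]; ring
      norm_map' := fun ψ => by
        change ‖(memLp_displaced ξ ψ).toLp _‖ = _
        rw [Lp.norm_toLp, Lp.norm_def]
        congr 1
        rw [← eLpNorm_comp_measurePreserving (Lp.memLp ψ).1
          (measurePreserving_add_right volume (shift ξ))]
        refine eLpNorm_congr_norm_ae (Filter.Eventually.of_forall fun x => ?_)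
        rw [norm_mul, mul_comm Complex.I, Complex.norm_exp_ofReal_mul_I, one_mul]
        rfl }

/-- The displacement operator `D(ξ) = exp(i ξᵀ Ω r)`, with `r = (x₁, p₁, …, xₙ, pₙ)` and
`p_j = -i ∂_j`. Since `ξᵀ Ω r = ∑ⱼ (a_j p_j - b_j x_j)` for `a_j = ξ (0, j)`, `b_j = ξ (1, j)`,
it acts on wave functions by `(D(ξ) ψ)(x) = exp(-i b·x - i a·b / 2) ψ(x + a)`. -/
def displacement {n : ℕ} (ξ : PhaseSpace n) : ModeSpace n →L[ℂ] ModeSpace n :=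
  (displacementIsometry ξ).toContinuousLinearMap

theorem displacement_coeFn {n : ℕ} (ξ : PhaseSpace n) (ψ : ModeSpace n) :
    displacement ξ ψ =ᵐ[volume]
      fun x => Complex.exp (Complex.I * phase ξ x) * ψ (x + shift ξ) :=
  MemLp.coeFn_toLp (memLp_displaced ξ ψ)

theorem norm_displacement_apply {n : ℕ} (ξ : PhaseSpace n) (ψ : ModeSpace n) :
    ‖displacement ξ ψ‖ = ‖ψ‖ :=
  (displacementIsometry ξ).norm_map ψ

/-- The Weyl form of the canonical commutation relations. -/
theorem displacement_comp {n : ℕ} (ξ η : PhaseSpace n) :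
    displacement ξ ∘L displacement η
      = Complex.exp (-(Complex.I / 2) * ((ξ ⬝ᵥ (Ω n).mulVec η : ℝ) : ℂ)) •
          displacement (ξ + η) := by
  ext1 ψ
  refine Lp.ext ?_
  simp only [ContinuousLinearMap.comp_apply, smul_apply]
  filter_upwards [displacement_coeFn ξ (displacement η ψ),
    ae_shift (shift ξ) (displacement_coeFn η ψ), displacement_coeFn (ξ + η) ψ,
    Lp.coeFn_smul (Complex.exp (-(Complex.I / 2) * ((ξ ⬝ᵥ (Ω n).mulVec η : ℝ) : ℂ)))
      (displacement (ξ + η) ψ)] with x h1 h2 h3 h4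
  rw [h1, h2, h4, Pi.smul_apply, h3, smul_eq_mul, ← mul_assoc, ← mul_assoc, ← Complex.exp_add,
    ← Complex.exp_add]
  have hs : x + shift (ξ + η) = x + shift ξ + shift η := by
    ext j; simp [shift, add_assoc]
  rw [hs]
  congr 2
  have key : phase ξ x + phase η (x + shift ξ)
      = -(1 / 2) * (ξ ⬝ᵥ (Ω n).mulVec η) + phase (ξ + η) x := by
    have : ξ ⬝ᵥ (Ω n).mulVec η = ∑ j, (ξ (0, j) * η (1, j) - ξ (1, j) * η (0, j)) := by
      simp [dotProduct, Matrix.mulVec, Ω, Matrix.blockDiagonal_apply, Fintype.sum_prod_type,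
        Fin.sum_univ_two, Finset.sum_sub_distrib, ← sub_eq_add_neg]
    rw [this]
    simp only [phase, shift, Pi.add_apply, mul_add, add_mul, Finset.sum_add_distrib,
      Finset.sum_sub_distrib]
    have c1 : ∑ j, η (1, j) * ξ (0, j) = ∑ j, ξ (0, j) * η (1, j) :=
      Finset.sum_congr rfl fun _ _ => mul_comm _ _
    have c2 : ∑ j, η (0, j) * ξ (1, j) = ∑ j, ξ (1, j) * η (0, j) :=
      Finset.sum_congr rfl fun _ _ => mul_comm _ _
    rw [c1, c2]
    ring
  have key' := congrArg (fun r : ℝ => (Complex.I * (r : ℂ))) key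
  push_cast at key' ⊢
  linear_combination key'

theorem displacement_zero (n : ℕ) : displacement (0 : PhaseSpace n) = 1 := by
  ext1 ψ
  refine Lp.ext ?_
  filter_upwards [displacement_coeFn 0 ψ] with x hx
  rw [hx]
  have : shift (0 : PhaseSpace n) = 0 := by ext j; simp [shift]
  simp [phase, this]

theorem displacement_comp_neg {n : ℕ} (ξ : PhaseSpace n) :
    displacement ξ ∘L displacement (-ξ) = 1 := by
  have h : ξ ⬝ᵥ (Ω n).mulVec (-ξ) = 0 := by
    simp [dotProduct, Matrix.mulVec, Ω, Matrix.blockDiagonal_apply, Fintype.sum_prod_type,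
      Fin.sum_univ_two, mul_comm]
  rw [displacement_comp, h]
  simp [displacement_zero]

theorem star_displacement {n : ℕ} (ξ : PhaseSpace n) :
    star (displacement ξ) = displacement (-ξ) := by
  have h1 : star (displacement ξ) * displacement ξ = 1 := by
    rw [ContinuousLinearMap.star_eq_adjoint]
    exact (ContinuousLinearMap.norm_map_iff_adjoint_comp_self _).mp (norm_displacement_apply ξ)
  exact left_inv_eq_right_inv h1 (displacement_comp_neg ξ)

theorem displacement_mem_unitary {n : ℕ} (ξ : PhaseSpace n) :
    displacement ξ ∈ unitary (ModeSpace n →L[ℂ] ModeSpace n) := by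
  rw [Unitary.mem_iff, star_displacement]
  refine ⟨?_, displacement_comp_neg ξ⟩
  have := displacement_comp_neg (-ξ)
  rwa [neg_neg] at this

/-- The characteristic function `χ_T(ξ) = Tr[T D(ξ)]`. -/
def charFn {n : ℕ} (T : traceClass (ModeSpace n)) (ξ : PhaseSpace n) : ℂ :=
  trace ((T : ModeSpace n →L[ℂ] ModeSpace n) ∘L displacement ξ)

/-! ### Bosonic channels -/

/-- A bosonic channel on `n` modes: a completely positive trace-preserving linear map on
trace-class operators. -/
def IsBosonicChannel {n : ℕ} (Φ : traceClass (ModeSpace n) →ₗ[ℂ] traceClass (ModeSpace n)) :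
    Prop :=
  IsCompletelyPositive Φ ∧ IsTracePreserving Φ

/-- A linear bosonic channel: a bosonic channel with `χ_{Φ(T)}(ξ) = χ_T(X ξ) f(ξ)` for some real
`2n × 2n` matrix `X` and some function `f : ℝ²ⁿ → ℂ`. -/
def IsLinearBosonicChannel {n : ℕ}
    (Φ : traceClass (ModeSpace n) →ₗ[ℂ] traceClass (ModeSpace n)) : Prop :=
  IsBosonicChannel Φ ∧
    ∃ (X : Matrix (Fin 2 × Fin n) (Fin 2 × Fin n) ℝ) (f : PhaseSpace n → ℂ),
      ∀ (T : traceClass (ModeSpace n)) (ξ : PhaseSpace n),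
        charFn (Φ T) ξ = charFn T (X.mulVec ξ) * f ξ

/-! ### Gaussian unitaries and Gaussian dilations -/

/-- The phase space `ℝ²ⁿ ⊕ ℝ²ᵐ` of a bipartite system of `n + m` modes. -/
abbrev JointPhaseSpace (n m : ℕ) : Type := (Fin 2 × Fin n) ⊕ (Fin 2 × Fin m) → ℝ

/-- The symplectic form of the bipartite system. -/
def jointΩ (n m : ℕ) :
    Matrix ((Fin 2 × Fin n) ⊕ (Fin 2 × Fin m)) ((Fin 2 × Fin n) ⊕ (Fin 2 × Fin m)) ℝ :=
  Matrix.fromBlocks (Ω n) 0 0 (Ω m)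

/-- The displacement operators `D(ξ ⊕ η) = D(ξ) ⊗ D(η)` of the bipartite system. -/
def jointDisplacement {n m : ℕ} (ζ : JointPhaseSpace n m) :
    HilbertTensor (ModeSpace n) (ModeSpace m) →L[ℂ] HilbertTensor (ModeSpace n) (ModeSpace m) :=
  opTensor (displacement fun i => ζ (Sum.inl i)) (displacement fun i => ζ (Sum.inr i))

/-- A symplectic unitary: a unitary `V` with `V† D(ζ) V = D(S ζ)` for all `ζ`, for some symplectic
matrix `S` (so that `χ_{V ρ V†}(ζ) = χ_ρ(S ζ)`). -/
def IsSymplecticUnitary {n m : ℕ}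
    (V : HilbertTensor (ModeSpace n) (ModeSpace m) →L[ℂ]
      HilbertTensor (ModeSpace n) (ModeSpace m)) : Prop :=
  V ∈ unitary (HilbertTensor (ModeSpace n) (ModeSpace m) →L[ℂ]
      HilbertTensor (ModeSpace n) (ModeSpace m)) ∧
    ∃ S : Matrix ((Fin 2 × Fin n) ⊕ (Fin 2 × Fin m)) ((Fin 2 × Fin n) ⊕ (Fin 2 × Fin m)) ℝ,
      S.transpose * jointΩ n m * S = jointΩ n m ∧
      ∀ ζ : JointPhaseSpace n m,
        star V ∘L jointDisplacement ζ ∘L V = jointDisplacement (S.mulVec ζ)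

/-- A Gaussian unitary: a displacement composed with a symplectic unitary. -/
def IsGaussianUnitary {n m : ℕ}
    (U : HilbertTensor (ModeSpace n) (ModeSpace m) →L[ℂ]
      HilbertTensor (ModeSpace n) (ModeSpace m)) : Prop :=
  ∃ (s : PhaseSpace n) (t : PhaseSpace m)
    (V : HilbertTensor (ModeSpace n) (ModeSpace m) →L[ℂ]
      HilbertTensor (ModeSpace n) (ModeSpace m)),
    IsSymplecticUnitary V ∧ U = opTensor (displacement s) (displacement t) ∘L V

/-- `Φ` is Gaussian dilatable: there are a number `m` of ancillary modes, an arbitrary `m`-mode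
state `σ` and a Gaussian unitary `U` with `Φ(ρ) = Tr_E[U (ρ ⊗ σ) U†]` for all states `ρ`. -/
def IsGaussianDilatable {n : ℕ}
    (Φ : traceClass (ModeSpace n) →ₗ[ℂ] traceClass (ModeSpace n)) : Prop :=
  ∃ (m : ℕ) (σ : traceClass (ModeSpace m))
    (U : HilbertTensor (ModeSpace n) (ModeSpace m) →L[ℂ]
      HilbertTensor (ModeSpace n) (ModeSpace m)),
    IsDensityOperator σ ∧ IsGaussianUnitary U ∧
    ∀ ρ : traceClass (ModeSpace n), IsDensityOperator ρ →
      IsPartialTrace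
        (U ∘L opTensor (ρ : ModeSpace n →L[ℂ] ModeSpace n)
          (σ : ModeSpace m →L[ℂ] ModeSpace m) ∘L star U) (Φ ρ)

/-! ### The binary displacement channel -/

theorem displaced_mem_traceClass {n : ℕ} (s : PhaseSpace n)
    {T : ModeSpace n →L[ℂ] ModeSpace n} (hT : T ∈ traceClass (ModeSpace n)) :
    displacement s ∘L T ∘L displacement (-s) ∈ traceClass (ModeSpace n) := by
  rw [← star_displacement]
  exact conj_mem_traceClass (displacement_mem_unitary s) hT

/-- The binary displacement channel `ρ ↦ ½ D(-s) ρ D(s) + ½ D(s) ρ D(-s)`. -/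
def binaryDisplacement {n : ℕ} (s : PhaseSpace n) :
    traceClass (ModeSpace n) →ₗ[ℂ] traceClass (ModeSpace n) where
  toFun T :=
    ⟨(1 / 2 : ℂ) • (displacement (-s) ∘L (T : ModeSpace n →L[ℂ] ModeSpace n) ∘L displacement s)
      + (1 / 2 : ℂ) • (displacement s ∘L (T : ModeSpace n →L[ℂ] ModeSpace n) ∘L
          displacement (-s)),
      add_mem
        (Submodule.smul_mem _ _ (by simpa using displaced_mem_traceClass (-s) T.2))
        (Submodule.smul_mem _ _ (displaced_mem_traceClass s T.2))⟩
  map_add' T T' := by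
    ext1
    simp only [Submodule.coe_add, ContinuousLinearMap.add_comp, ContinuousLinearMap.comp_add,
      smul_add]
    abel
  map_smul' c T := by
    ext1
    simp only [Submodule.coe_smul, ContinuousLinearMap.smul_comp, ContinuousLinearMap.comp_smul,
      RingHom.id_apply, smul_add, smul_comm c]

end Modes

end Bosonic

end

/-! Everything is read off characteristic functions. The two displaced copies of `T` carry phases
`exp(± i s·Ωξ)`, so the channel multiplies `χ_T(ξ)` by `cos(s·Ωξ)` (`charFn_binaryDisplacement`);
complete positivity holds because the channel is a mixture of unitary conjugations. A Gaussian
dilation with ancilla state `σ` yields instead `exp(iθ(ξ)) χ_ρ(Xξ) χ_σ(Yξ)` with `X` and `Y` linear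
(`IsGaussianDilatable.exists_charFn_eq`).

Suppose the two expressions agree on all states. Displacing the test state changes the two sides by
phases that can match only if `Xξ = ξ`, wherever the cosine is nonzero; there `|χ_σ(Yξ)| =
|cos(s·Ωξ)|`. Choose `ξ` with `s·Ωξ = π`. The modulus is then `1` at every `k Yξ`, `k ∈ ℕ`, whereas
the characteristic function of a trace-class operator decays along every ray
(`tendsto_charFn_zero`). Hence `Yξ = 0`, so at `ξ/2` the dilation contributes the factor `χ_σ(0) =
1` where the channel has `cos(π/2) = 0`: a contradiction.

The decay follows from the Weyl relations and strong continuity of displacements. The trace calculus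
it rests on writes positive operators of finite trace as `S† S` with `S` Hilbert-Schmidt. -/

namespace Bosonic

/-! ### Hilbert-Schmidt operators and the trace calculus. -/

section HilbertSchmidt

open ContinuousLinearMap

universe u v w

variable {H : Type u} [NormedAddCommGroup H] [InnerProductSpace ℂ H]

theorem hasSum_norm_inner_sq {ι : Type v} (b : HilbertBasis ι ℂ H) (x : H) :
    HasSum (fun i => ‖⟪b i, x⟫_ℂ‖ ^ 2) (‖x‖ ^ 2) := by
  have h := b.hasSum_inner_mul_inner x x
  rw [inner_self_eq_norm_sq_to_K] at h
  refine Complex.hasSum_ofReal.1 ?_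
  convert! h using 1
  · funext i
    rw [← inner_conj_symm x (b i), RCLike.conj_mul]
    simp
  · simp

theorem summable_matrix_sq {ι : Type v} {κ : Type w} {b : ι → H}
    (c : HilbertBasis κ ℂ H) {S : H →L[ℂ] H} (hS : Summable fun i => ‖S (b i)‖ ^ 2) :
    Summable fun p : ι × κ => ‖⟪c p.2, S (b p.1)⟫_ℂ‖ ^ 2 := by
  have h0 : (0 : ι × κ → ℝ) ≤ fun p => ‖⟪c p.2, S (b p.1)⟫_ℂ‖ ^ 2 :=
    fun p => sq_nonneg _
  rw [summable_prod_of_nonneg h0]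
  exact ⟨fun i => (hasSum_norm_inner_sq c (S (b i))).summable,
    hS.congr fun i => (hasSum_norm_inner_sq c (S (b i))).tsum_eq.symm⟩

variable [CompleteSpace H]

/-- The Hilbert-Schmidt norm of `S` in one basis bounds that of its adjoint in any other. -/
theorem summable_adjoint_sq {ι : Type v} {κ : Type w} (b : HilbertBasis ι ℂ H)
    (c : HilbertBasis κ ℂ H) {S : H →L[ℂ] H} (hS : Summable fun i => ‖S (b i)‖ ^ 2) :
    Summable fun j => ‖adjoint S (c j)‖ ^ 2 := by
  -- The matrix entries of `S` are square summable over all pairs of indices; summing over `i` first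
  -- gives the squared norms of the vectors `S† (c j)`.
  have h' := (summable_matrix_sq c hS).prod_symm.prod
  refine h'.congr fun j => ?_
  rw [← (hasSum_norm_inner_sq b (adjoint S (c j))).tsum_eq]
  refine tsum_congr fun i => ?_
  simp only [Prod.swap]
  rw [← adjoint_inner_left, norm_inner_symm]

theorem summable_sq_of_summable_sq {ι : Type v} {κ : Type w} (b : HilbertBasis ι ℂ H)
    (c : HilbertBasis κ ℂ H) {S : H →L[ℂ] H} (hS : Summable fun i => ‖S (b i)‖ ^ 2) :
    Summable fun j => ‖S (c j)‖ ^ 2 := by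
  simpa using summable_adjoint_sq b c (summable_adjoint_sq b b hS)

/-- Taking adjoints turns the right factor `B` into a left factor `B†`, which costs only its
operator norm. -/
theorem summable_comp_sq {ι : Type v} (b : HilbertBasis ι ℂ H) {S : H →L[ℂ] H} (B : H →L[ℂ] H)
    (hS : Summable fun i => ‖S (b i)‖ ^ 2) : Summable fun i => ‖(S ∘L B) (b i)‖ ^ 2 := by
  have h : Summable fun i => ‖(adjoint B ∘L adjoint S) (b i)‖ ^ 2 := by
    refine Summable.of_nonneg_of_le (fun _ => by positivity) (fun i => ?_)
      ((summable_adjoint_sq b b hS).mul_left (‖adjoint B‖ ^ 2))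
    rw [← mul_pow]
    gcongr
    exact (adjoint B).le_opNorm (adjoint S (b i))
  rw [← adjoint_comp] at h
  simpa using summable_adjoint_sq b b h

/-- The Hilbert-Schmidt inner product of two operators, computed from them in one basis or from
their adjoints in another. -/
theorem exists_hasSum_inner {ι : Type v} {κ : Type w} (b : HilbertBasis ι ℂ H)
    (c : HilbertBasis κ ℂ H) {K L : H →L[ℂ] H} (hK : Summable fun i => ‖K (b i)‖ ^ 2)
    (hL : Summable fun i => ‖L (b i)‖ ^ 2) :
    ∃ t : ℂ, HasSum (fun i => ⟪K (b i), L (b i)⟫_ℂ) t ∧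
      HasSum (fun j => ⟪adjoint L (c j), adjoint K (c j)⟫_ℂ) t := by
  -- Absolute convergence over pairs, from `xy ≤ x² + y²`, lets the double sum be evaluated in
  -- either order.
  have h : Summable fun p : ι × κ => ⟪K (b p.1), c p.2⟫_ℂ * ⟪c p.2, L (b p.1)⟫_ℂ := by
    refine Summable.of_norm_bounded ((summable_matrix_sq c hK).add (summable_matrix_sq c hL)) fun p => ?_
    rw [norm_mul, norm_inner_symm]
    generalize ‖⟪c p.2, K (b p.1)⟫_ℂ‖ = x
    generalize ‖⟪c p.2, L (b p.1)⟫_ℂ‖ = y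
    nlinarith [sq_nonneg (x - y), sq_nonneg x, sq_nonneg y]
  obtain ⟨t, ht⟩ := h
  have h' : HasSum (fun p : κ × ι => ⟪K (b p.2), c p.1⟫_ℂ * ⟪c p.1, L (b p.2)⟫_ℂ) t :=
    (Equiv.prodComm κ ι).hasSum_iff.2 ht
  refine ⟨t, HasSum.prod_fiberwise ht fun i => c.hasSum_inner_mul_inner (K (b i)) (L (b i)),
    HasSum.prod_fiberwise h' fun j => ?_⟩
  have hj := b.hasSum_inner_mul_inner (adjoint L (c j)) (adjoint K (c j))
  refine hj.congr_fun fun i => ?_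
  rw [adjoint_inner_left, adjoint_inner_right, mul_comm]

/-- A positive operator with finite trace is `S† S` with `S` Hilbert-Schmidt in every basis. -/
theorem IsPositiveFiniteTrace.exists_eq_adjoint_comp {A : H →L[ℂ] H}
    (hA : IsPositiveFiniteTrace A) :
    ∃ S : H →L[ℂ] H, A = adjoint S ∘L S ∧
      ∀ {κ : Type u} (c : HilbertBasis κ ℂ H), Summable fun j => ‖S (c j)‖ ^ 2 := by
  obtain ⟨hp, ι, b, hs⟩ := hA
  obtain ⟨S, rfl⟩ := CStarAlgebra.nonneg_iff_eq_star_mul_self.1 ((nonneg_iff_isPositive A).2 hp)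
  refine ⟨S, rfl, fun c => summable_sq_of_summable_sq b c (hs.congr fun i => ?_)⟩
  rw [mul_def, comp_apply, star_eq_adjoint, adjoint_inner_right, inner_self_eq_norm_sq_to_K]
  norm_cast

theorem IsPositiveFiniteTrace.of_adjoint_comp {κ : Type u} (c : HilbertBasis κ ℂ H)
    {S : H →L[ℂ] H} (hS : Summable fun j => ‖S (c j)‖ ^ 2) :
    IsPositiveFiniteTrace (adjoint S ∘L S) := by
  refine ⟨isPositive_adjoint_comp_self S, κ, c, hS.congr fun i => ?_⟩
  rw [comp_apply, adjoint_inner_right, inner_self_eq_norm_sq_to_K]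
  norm_cast

/-! ### The trace of a trace-class operator times a bounded operator -/

/-- For Hilbert-Schmidt `S`, the trace of `S† S B` in any basis, also computed cyclically. -/
theorem hasSum_trace_adjoint_comp {S : H →L[ℂ] H}
    (hS : ∀ {κ : Type u} (c : HilbertBasis κ ℂ H), Summable fun j => ‖S (c j)‖ ^ 2)
    (B : H →L[ℂ] H) {κ κ' : Type u} (c : HilbertBasis κ ℂ H) (c' : HilbertBasis κ' ℂ H) :
    HasSum (fun j => ⟪c j, ((adjoint S ∘L S) ∘L B) (c j)⟫_ℂ)
        (trace ((adjoint S ∘L S) ∘L B)) ∧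
      HasSum (fun j => ⟪adjoint S (c' j), B (adjoint S (c' j))⟫_ℂ)
        (trace ((adjoint S ∘L S) ∘L B)) := by
  set d := (exists_hilbertBasis ℂ H).choose_spec.choose with hd
  have key : ∀ {κ : Type u} (c : HilbertBasis κ ℂ H),
      (fun j => ⟪c j, ((adjoint S ∘L S) ∘L B) (c j)⟫_ℂ)
        = fun j => ⟪S (c j), (S ∘L B) (c j)⟫_ℂ := fun c => by
    ext j
    rw [comp_apply, comp_apply, adjoint_inner_right, comp_apply]
  have swap : (fun j => ⟪adjoint S (c' j), B (adjoint S (c' j))⟫_ℂ)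
      = fun j => ⟪adjoint (S ∘L B) (c' j), adjoint S (c' j)⟫_ℂ := by
    ext j
    rw [adjoint_comp, comp_apply, adjoint_inner_left B]
  -- The basis `d` built into `trace` and the arbitrary basis `c` are both compared with the same
  -- cyclic sum over `c'`, so their sums coincide.
  obtain ⟨t, h1, h2⟩ := exists_hasSum_inner d c' (hS d) (summable_comp_sq d B (hS d))
  obtain ⟨t', h3, h4⟩ := exists_hasSum_inner c c' (hS c) (summable_comp_sq c B (hS c))
  have ht : trace ((adjoint S ∘L S) ∘L B) = t := by
    rw [trace, ← hd]
    have := congrArg (fun f => ∑' j, f j) (key d)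
    exact this.trans h1.tsum_eq
  rw [key, swap, ht]
  exact ⟨h4.unique h2 ▸ h3, h2⟩

theorem hasSum_trace_comp {T : H →L[ℂ] H} (hT : T ∈ traceClass H) (B : H →L[ℂ] H)
    {κ : Type u} (c : HilbertBasis κ ℂ H) :
    HasSum (fun j => ⟪c j, (T ∘L B) (c j)⟫_ℂ) (trace (T ∘L B)) := by
  -- With `t` quantified before the basis, convergence and basis independence pass through the
  -- induction together.
  suffices h : ∃ t, ∀ {κ : Type u} (c : HilbertBasis κ ℂ H),
      HasSum (fun j => ⟪c j, (T ∘L B) (c j)⟫_ℂ) t by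
    obtain ⟨t, ht⟩ := h
    rw [trace, (ht _).tsum_eq]
    exact ht c
  induction hT using Submodule.span_induction with
  | mem A hA =>
    obtain ⟨S, rfl, hS⟩ := IsPositiveFiniteTrace.exists_eq_adjoint_comp hA
    exact ⟨_, fun c => (hasSum_trace_adjoint_comp hS B c c).1⟩
  | zero => exact ⟨0, fun c => by simp⟩
  | add x y _ _ hx hy =>
    obtain ⟨t, ht⟩ := hx
    obtain ⟨t', ht'⟩ := hy
    refine ⟨t + t', fun c => ?_⟩
    simpa only [add_comp, add_apply, inner_add_right] using (ht c).add (ht' c)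
  | smul a x _ hx =>
    obtain ⟨t, ht⟩ := hx
    refine ⟨a * t, fun c => ?_⟩
    simpa only [smul_comp, smul_apply, inner_smul_right] using (ht c).mul_left a

theorem trace_comp_eq {T : H →L[ℂ] H} (hT : T ∈ traceClass H) (B : H →L[ℂ] H)
    {κ : Type u} (c : HilbertBasis κ ℂ H) :
    trace (T ∘L B) = ∑' j, ⟪c j, (T ∘L B) (c j)⟫_ℂ :=
  (hasSum_trace_comp hT B c).tsum_eq.symm

theorem trace_smul (a : ℂ) (T : H →L[ℂ] H) : trace (a • T) = a * trace T := by
  simp only [trace, smul_apply, inner_smul_right, tsum_mul_left]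

/-- Unlike scaling, additivity of a `tsum` requires both series to converge, which is where trace
class enters. -/
theorem trace_add_comp {T T' : H →L[ℂ] H} (hT : T ∈ traceClass H) (hT' : T' ∈ traceClass H)
    (B : H →L[ℂ] H) : trace ((T + T') ∘L B) = trace (T ∘L B) + trace (T' ∘L B) := by
  obtain ⟨ι, c, -⟩ := exists_hilbertBasis ℂ H
  have h := (hasSum_trace_comp hT B c).add (hasSum_trace_comp hT' B c)
  refine (hasSum_trace_comp (add_mem hT hT') B c).unique ?_
  simpa only [add_comp, add_apply, inner_add_right] using h

/-- Unitary invariance of the trace. -/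
theorem trace_conj_comp {U T : H →L[ℂ] H} (hU : U ∈ unitary (H →L[ℂ] H))
    (hT : T ∈ traceClass H) (B : H →L[ℂ] H) :
    trace ((U ∘L T ∘L star U) ∘L B) = trace (T ∘L (star U ∘L B ∘L U)) := by
  obtain ⟨ι, b, -⟩ := exists_hilbertBasis ℂ H
  set c := HilbertBasis.ofRepr ((Unitary.linearIsometryEquiv ⟨U, hU⟩).symm.trans b.repr) with hc
  have hb : ∀ i, c i = U (b i) := by
    intro i
    classical
    rw [← HilbertBasis.repr_symm_single, ← HilbertBasis.repr_symm_single]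
    rfl
  have h1 : ∀ x, (star U) (U x) = x := fun x =>
    congrArg (fun f : H →L[ℂ] H => f x) (Unitary.mem_iff.mp hU).1
  rw [trace_comp_eq (conj_mem_traceClass hU hT) B c, trace_comp_eq hT _ b]
  refine tsum_congr fun i => ?_
  rw [hb]
  simp only [comp_apply]
  rw [← adjoint_inner_right, ← star_eq_adjoint, h1]

/-- If bounded operators converge weakly to zero, so do their expectation values in any
trace-class operator. -/
theorem tendsto_trace_comp_zero {T : H →L[ℂ] H} (hT : T ∈ traceClass H) {D : ℕ → H →L[ℂ] H}
    {C : ℝ} (hD : ∀ k, ‖D k‖ ≤ C)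
    (h : ∀ φ : H, Filter.Tendsto (fun k => ⟪φ, D k φ⟫_ℂ) Filter.atTop (nhds 0)) :
    Filter.Tendsto (fun k => trace (T ∘L D k)) Filter.atTop (nhds 0) := by
  induction hT using Submodule.span_induction with
  | mem A hA =>
    obtain ⟨S, rfl, hS⟩ := IsPositiveFiniteTrace.exists_eq_adjoint_comp hA
    obtain ⟨ι, c, -⟩ := exists_hilbertBasis ℂ H
    -- In cyclic form the trace is a sum of expectation values of `D k` in the fixed vectors `S† (c
    -- j)`, so weak convergence applies termwise and dominated convergence finishes.
    simp only [← (hasSum_trace_adjoint_comp hS _ c c).2.tsum_eq]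
    rw [← tsum_zero (α := ℂ) (β := ι)]
    refine tendsto_tsum_of_dominated_convergence
      (bound := fun j => C * ‖adjoint S (c j)‖ ^ 2)
      ((summable_adjoint_sq c c (hS c)).mul_left C) (fun j => h _)
      (Filter.Eventually.of_forall fun k j => ?_)
    calc ‖⟪adjoint S (c j), D k (adjoint S (c j))⟫_ℂ‖
        ≤ ‖adjoint S (c j)‖ * (C * ‖adjoint S (c j)‖) :=
          (norm_inner_le_norm _ _).trans
            (mul_le_mul_of_nonneg_left ((D k).le_of_opNorm_le (hD k) _) (norm_nonneg _))
      _ = C * ‖adjoint S (c j)‖ ^ 2 := by ring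
  | zero => simp [trace]
  | add x y hx' hy' hx hy =>
    simp only [trace_add_comp (T := x) (T' := y) hx' hy']
    simpa using hx.add hy
  | smul a x _ hx =>
    simp only [smul_comp, trace_smul]
    simpa using hx.const_mul a

/-- Pure states. -/
theorem isPositiveFiniteTrace_rankOne (ψ : H) :
    IsPositiveFiniteTrace (InnerProductSpace.rankOne ℂ ψ ψ) := by
  obtain ⟨ι, c, -⟩ := exists_hilbertBasis ℂ H
  refine ⟨InnerProductSpace.isPositive_rankOne_self ψ, ι, c,
    (hasSum_norm_inner_sq c ψ).summable.congr fun i => ?_⟩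
  rw [InnerProductSpace.rankOne_apply, inner_smul_right, ← inner_conj_symm ψ, RCLike.conj_mul]
  norm_cast

theorem trace_rankOne_comp (ψ : H) (B : H →L[ℂ] H) :
    trace (InnerProductSpace.rankOne ℂ ψ ψ ∘L B) = ⟪ψ, B ψ⟫_ℂ := by
  obtain ⟨ι, c, -⟩ := exists_hilbertBasis ℂ H
  rw [trace_comp_eq (Submodule.subset_span (isPositiveFiniteTrace_rankOne ψ)) B c]
  rw [← adjoint_inner_left, ← c.tsum_inner_mul_inner]
  refine tsum_congr fun i => ?_
  rw [comp_apply, InnerProductSpace.rankOne_apply, inner_smul_right, adjoint_inner_left]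

end HilbertSchmidt

/-! ### Operators and traces on the Hilbert-space tensor product. -/

section Tensor

open ContinuousLinearMap

universe u

variable {H K : Type u} [NormedAddCommGroup H] [InnerProductSpace ℂ H]
  [NormedAddCommGroup K] [InnerProductSpace ℂ K]

theorem hilbertTensor_ext {F : Type*} [NormedAddCommGroup F] [NormedSpace ℂ F]
    {f g : HilbertTensor H K →L[ℂ] F}
    (h : ∀ x y, f ((x ⊗ₜ[ℂ] y : H ⊗[ℂ] K) : HilbertTensor H K)
      = g ((x ⊗ₜ[ℂ] y : H ⊗[ℂ] K) : HilbertTensor H K)) : f = g := by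
  refine ContinuousLinearMap.ext fun z => ?_
  induction z using UniformSpace.Completion.induction_on with
  | hp => exact isClosed_eq f.continuous g.continuous
  | ih z =>
    induction z using TensorProduct.induction_on with
    | zero => rw [UniformSpace.Completion.coe_zero, map_zero, map_zero]
    | tmul x y => exact h x y
    | add x y hx hy => rw [UniformSpace.Completion.coe_add, map_add, map_add, hx, hy]

theorem opTensor_comp (A A' : H →L[ℂ] H) (B B' : K →L[ℂ] K) :
    opTensor A B ∘L opTensor A' B' = opTensor (A ∘L A') (B ∘L B') :=
  hilbertTensor_ext fun x y => by simp [opTensor_coe_tmul]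

theorem opTensor_add_left (A A' : H →L[ℂ] H) (B : K →L[ℂ] K) :
    opTensor (A + A') B = opTensor A B + opTensor A' B :=
  hilbertTensor_ext fun x y => by
    simp only [opTensor_coe_tmul, add_apply, TensorProduct.add_tmul,
      UniformSpace.Completion.coe_add]

theorem opTensor_add_right (A : H →L[ℂ] H) (B B' : K →L[ℂ] K) :
    opTensor A (B + B') = opTensor A B + opTensor A B' :=
  hilbertTensor_ext fun x y => by
    simp only [opTensor_coe_tmul, add_apply, TensorProduct.tmul_add,
      UniformSpace.Completion.coe_add]

theorem opTensor_smul_left (a : ℂ) (A : H →L[ℂ] H) (B : K →L[ℂ] K) :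
    opTensor (a • A) B = a • opTensor A B :=
  hilbertTensor_ext fun x y => by
    simp only [opTensor_coe_tmul, smul_apply, ← TensorProduct.smul_tmul',
      UniformSpace.Completion.coe_smul]

theorem opTensor_smul_right (a : ℂ) (A : H →L[ℂ] H) (B : K →L[ℂ] K) :
    opTensor A (a • B) = a • opTensor A B :=
  hilbertTensor_ext fun x y => by
    simp only [opTensor_coe_tmul, smul_apply, TensorProduct.tmul_smul,
      UniformSpace.Completion.coe_smul]

theorem opTensor_zero_left (B : K →L[ℂ] K) : opTensor (0 : H →L[ℂ] H) B = 0 := by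
  simpa using opTensor_smul_left 0 (0 : H →L[ℂ] H) B

theorem opTensor_zero_right (A : H →L[ℂ] H) : opTensor A (0 : K →L[ℂ] K) = 0 := by
  simpa using opTensor_smul_right 0 A (0 : K →L[ℂ] K)

theorem opTensor_one : opTensor (1 : H →L[ℂ] H) (1 : K →L[ℂ] K) = 1 :=
  hilbertTensor_ext fun x y => by simp [opTensor_coe_tmul]

theorem inner_coe_tmul (x x' : H) (y y' : K) :
    ⟪((x ⊗ₜ[ℂ] y : H ⊗[ℂ] K) : HilbertTensor H K),
      ((x' ⊗ₜ[ℂ] y' : H ⊗[ℂ] K) : HilbertTensor H K)⟫_ℂ = ⟪x, x'⟫_ℂ * ⟪y, y'⟫_ℂ := by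
  rw [UniformSpace.Completion.inner_coe, TensorProduct.inner_tmul]

theorem orthonormal_coe_tmul {ι κ : Type*} {b : ι → H} {c : κ → K} (hb : Orthonormal ℂ b)
    (hc : Orthonormal ℂ c) :
    Orthonormal ℂ fun p : ι × κ =>
      ((b p.1 ⊗ₜ[ℂ] c p.2 : H ⊗[ℂ] K) : HilbertTensor H K) :=
  (hb.tmul hc).comp_linearIsometry
    (UniformSpace.Completion.toComplₗᵢ (𝕜 := ℂ) (E := H ⊗[ℂ] K))

theorem hilbertBasis_ext {ι F : Type*} [NormedAddCommGroup F] [NormedSpace ℂ F]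
    (b : HilbertBasis ι ℂ H) {f g : H →L[ℂ] F} (h : ∀ i, f (b i) = g (b i)) : f = g := by
  refine ContinuousLinearMap.ext_on (s := Set.range b) ?_ ?_
  · exact (Submodule.dense_iff_topologicalClosure_eq_top).2 b.dense_span
  · rintro _ ⟨i, rfl⟩
    exact h i

/-- The product basis of the Hilbert-space tensor product. -/
noncomputable def tensorBasis {ι κ : Type*} (b : HilbertBasis ι ℂ H) (c : HilbertBasis κ ℂ K) :
    HilbertBasis (ι × κ) ℂ (HilbertTensor H K) :=
  HilbertBasis.mkOfOrthogonalEqBot (orthonormal_coe_tmul b.orthonormal c.orthonormal) <| by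
    rw [Submodule.eq_bot_iff]
    intro z hz
    have hz' : ∀ i j, ⟪z, ((b i ⊗ₜ[ℂ] c j : H ⊗[ℂ] K) : HilbertTensor H K)⟫_ℂ = 0 :=
      fun i j => Submodule.inner_left_of_mem_orthogonal
        (Submodule.subset_span (Set.mem_range_self (i, j))) hz
    -- `J x y = ⟪z, x ⊗ y⟫` is continuous in each variable, so vanishing on the two bases forces `J
    -- = 0`; then `z` is orthogonal to every simple tensor, hence to itself.
    let J : H →L[ℂ] K →L[ℂ] ℂ :=
      (compL ℂ K (H ⊗[ℂ] K) ℂ (innerSL ℂ z ∘L UniformSpace.Completion.toComplL)) ∘L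
        TensorProduct.mkL ℂ H K
    have hJ : J = 0 := hilbertBasis_ext b fun i => hilbertBasis_ext c fun j => hz' i j
    have h : innerSL ℂ z = 0 := hilbertTensor_ext fun x y =>
      congrArg (fun f : H →L[ℂ] K →L[ℂ] ℂ => f x y) hJ
    have := congrArg (fun f : HilbertTensor H K →L[ℂ] ℂ => f z) h
    simpa using this

theorem tensorBasis_apply {ι κ : Type*} (b : HilbertBasis ι ℂ H) (c : HilbertBasis κ ℂ K)
    (p : ι × κ) :
    tensorBasis b c p = ((b p.1 ⊗ₜ[ℂ] c p.2 : H ⊗[ℂ] K) : HilbertTensor H K) := by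
  rw [tensorBasis, HilbertBasis.coe_mkOfOrthogonalEqBot]

variable [CompleteSpace H] [CompleteSpace K]

theorem adjoint_opTensor (A : H →L[ℂ] H) (B : K →L[ℂ] K) :
    adjoint (opTensor A B) = opTensor (adjoint A) (adjoint B) := by
  refine hilbertTensor_ext fun x y => ext_inner_right ℂ fun z => ?_
  rw [adjoint_inner_left, opTensor_coe_tmul]
  -- Both sides are continuous and linear in the test vector `z`, so simple tensors suffice.
  have h : innerSL ℂ ((x ⊗ₜ[ℂ] y : H ⊗[ℂ] K) : HilbertTensor H K) ∘L opTensor A B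
      = innerSL ℂ ((adjoint A x ⊗ₜ[ℂ] adjoint B y : H ⊗[ℂ] K) : HilbertTensor H K) :=
    hilbertTensor_ext fun x' y' => by
      rw [comp_apply, opTensor_coe_tmul, innerSL_apply_apply, innerSL_apply_apply,
        inner_coe_tmul, inner_coe_tmul, adjoint_inner_left, adjoint_inner_left]
  exact congrArg (fun f : HilbertTensor H K →L[ℂ] ℂ => f z) h

/-- If `A = S† S` and `B = R† R`, then `A ⊗ B = (S ⊗ R)† (S ⊗ R)`, and the squared norms of `S ⊗ R`
on the product basis are products. -/
theorem IsPositiveFiniteTrace.opTensor {A : H →L[ℂ] H} {B : K →L[ℂ] K}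
    (hA : IsPositiveFiniteTrace A) (hB : IsPositiveFiniteTrace B) :
    IsPositiveFiniteTrace (opTensor A B) := by
  obtain ⟨S, rfl, hS⟩ := hA.exists_eq_adjoint_comp
  obtain ⟨R, rfl, hR⟩ := hB.exists_eq_adjoint_comp
  obtain ⟨ι, b, -⟩ := exists_hilbertBasis ℂ H
  obtain ⟨κ, c, -⟩ := exists_hilbertBasis ℂ K
  rw [← opTensor_comp, ← adjoint_opTensor]
  refine IsPositiveFiniteTrace.of_adjoint_comp (tensorBasis b c) ?_
  refine ((hS b).mul_of_nonneg (hR c) (fun _ => sq_nonneg _) (fun _ => sq_nonneg _)).congr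
    fun p => ?_
  rw [tensorBasis_apply, opTensor_coe_tmul, UniformSpace.Completion.norm_coe,
    TensorProduct.norm_tmul, mul_pow]

theorem opTensor_mem_traceClass {A : H →L[ℂ] H} {B : K →L[ℂ] K} (hA : A ∈ traceClass H)
    (hB : B ∈ traceClass K) : opTensor A B ∈ traceClass (HilbertTensor H K) := by
  induction hA using Submodule.span_induction with
  | mem A hA =>
    induction hB using Submodule.span_induction with
    | mem B hB => exact Submodule.subset_span (IsPositiveFiniteTrace.opTensor hA hB)
    | zero => simp [opTensor_zero_right]
    | add x y _ _ hx hy => simpa only [opTensor_add_right] using add_mem hx hy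
    | smul a x _ hx => simpa only [opTensor_smul_right] using Submodule.smul_mem _ a hx
  | zero => simp [opTensor_zero_left]
  | add x y _ _ hx hy => simpa only [opTensor_add_left] using add_mem hx hy
  | smul a x _ hx => simpa only [opTensor_smul_left] using Submodule.smul_mem _ a hx

/-- The trace of a product operator factorizes. -/
theorem trace_opTensor_comp {A : H →L[ℂ] H} {B : K →L[ℂ] K} (hA : A ∈ traceClass H)
    (hB : B ∈ traceClass K) (C : H →L[ℂ] H) (D : K →L[ℂ] K) :
    trace (opTensor A B ∘L opTensor C D) = trace (A ∘L C) * trace (B ∘L D) := by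
  obtain ⟨ι, b, -⟩ := exists_hilbertBasis ℂ H
  obtain ⟨κ, c, -⟩ := exists_hilbertBasis ℂ K
  rw [trace_comp_eq (opTensor_mem_traceClass hA hB) _ (tensorBasis b c), trace_comp_eq hA C b,
    trace_comp_eq hB D c, tsum_mul_tsum_of_summable_norm (hasSum_trace_comp hA C b).summable.norm
      (hasSum_trace_comp hB D c).summable.norm]
  refine tsum_congr fun p => ?_
  rw [opTensor_comp, tensorBasis_apply, opTensor_coe_tmul, inner_coe_tmul]

end Tensor

/-! ### Displacement operators: covariance, strong continuity and weak decay. -/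

section Displacement

open ContinuousLinearMap MeasureTheory Filter Topology

variable {n : ℕ}

/-! ### The symplectic form -/

theorem dotProduct_Ω_mulVec (ξ η : PhaseSpace n) :
    ξ ⬝ᵥ (Ω n).mulVec η = ∑ j, (ξ (0, j) * η (1, j) - ξ (1, j) * η (0, j)) := by
  simp [dotProduct, Matrix.mulVec, Ω, Matrix.blockDiagonal_apply, Fintype.sum_prod_type,
    Fin.sum_univ_two, Finset.sum_sub_distrib, ← sub_eq_add_neg]

theorem dotProduct_Ω_mulVec_swap (ξ η : PhaseSpace n) :
    ξ ⬝ᵥ (Ω n).mulVec η = -(η ⬝ᵥ (Ω n).mulVec ξ) := by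
  rw [dotProduct_Ω_mulVec, dotProduct_Ω_mulVec, ← Finset.sum_neg_distrib]
  exact Finset.sum_congr rfl fun j _ => by ring

theorem dotProduct_Ω_mulVec_self (ξ : PhaseSpace n) : ξ ⬝ᵥ (Ω n).mulVec ξ = 0 := by
  have := dotProduct_Ω_mulVec_swap ξ ξ
  linarith

/-- The symplectic form is nondegenerate; a dual vector can be taken to be a pure momentum or a
pure position displacement. -/
theorem exists_dotProduct_Ω_ne_zero {η : PhaseSpace n} (hη : η ≠ 0) :
    ∃ ξ : PhaseSpace n, ((∀ j, ξ (0, j) = 0) ∨ ∀ j, ξ (1, j) = 0) ∧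
      ξ ⬝ᵥ (Ω n).mulVec η ≠ 0 := by
  obtain ⟨⟨i, j⟩, hij⟩ := Function.ne_iff.1 hη
  rw [Pi.zero_apply] at hij
  fin_cases i
  · refine ⟨Pi.single (1, j) 1, Or.inl fun l => by simp, ?_⟩
    have : (Pi.single (1, j) (1 : ℝ) : PhaseSpace n) ⬝ᵥ (Ω n).mulVec η = -η (0, j) := by
      rw [dotProduct_Ω_mulVec]
      simp [Pi.single_apply]
    rw [this]
    exact neg_ne_zero.2 hij
  · refine ⟨Pi.single (0, j) 1, Or.inr fun l => by simp, ?_⟩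
    have : (Pi.single (0, j) (1 : ℝ) : PhaseSpace n) ⬝ᵥ (Ω n).mulVec η = η (1, j) := by
      rw [dotProduct_Ω_mulVec]
      simp [Pi.single_apply]
    rw [this]
    exact hij

theorem exists_dotProduct_Ω_eq {η : PhaseSpace n} (hη : η ≠ 0) (t : ℝ) :
    ∃ ξ : PhaseSpace n, ξ ⬝ᵥ (Ω n).mulVec η = t := by
  obtain ⟨ξ, -, h⟩ := exists_dotProduct_Ω_ne_zero hη
  refine ⟨(t / (ξ ⬝ᵥ (Ω n).mulVec η)) • ξ, ?_⟩
  rw [smul_dotProduct, smul_eq_mul, div_mul_cancel₀ _ h]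

/-! ### Displacement operators -/

/-- Displacing a state only multiplies its characteristic function by a phase. This drives the decay
estimate, the formula for the channel and the identification of `X`. -/
theorem displacement_conj (ζ ξ : PhaseSpace n) :
    displacement (-ζ) ∘L displacement ξ ∘L displacement ζ
      = Complex.exp (Complex.I * ((ζ ⬝ᵥ (Ω n).mulVec ξ : ℝ) : ℂ)) • displacement ξ := by
  rw [displacement_comp, comp_smul, displacement_comp, smul_smul, ← Complex.exp_add,
    dotProduct_Ω_mulVec_swap ξ ζ, Matrix.mulVec_add, dotProduct_add, neg_dotProduct,
    neg_dotProduct, dotProduct_Ω_mulVec_self]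
  congr 2
  · push_cast
    ring
  · abel

theorem inner_displacement_conj (ζ ξ : PhaseSpace n) (ψ : ModeSpace n) :
    ⟪displacement ζ ψ, displacement ξ (displacement ζ ψ)⟫_ℂ
      = Complex.exp (Complex.I * ((ζ ⬝ᵥ (Ω n).mulVec ξ : ℝ) : ℂ)) * ⟪ψ, displacement ξ ψ⟫_ℂ := by
  rw [← adjoint_inner_right, ← star_eq_adjoint, star_displacement, ← inner_smul_right,
    ← smul_apply, ← displacement_conj]
  rfl

theorem norm_displacement_le (ξ : PhaseSpace n) : ‖displacement ξ‖ ≤ 1 :=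
  opNorm_le_bound _ zero_le_one fun ψ => by rw [norm_displacement_apply, one_mul]

/-- Here `D` is multiplication by a phase, so dominated convergence handles `⟪φ, D φ⟫`; as `D` is
isometric, `‖D φ - φ‖² = 2‖φ‖² - 2 Re ⟪φ, D φ⟫` upgrades this to norm convergence. -/
theorem tendsto_displacement_of_shift_eq_zero {ξ : PhaseSpace n} (hξ : ∀ j, ξ (0, j) = 0)
    {t : ℕ → ℝ} (ht : Tendsto t atTop (𝓝 0)) (φ : ModeSpace n) :
    Tendsto (fun k => displacement (t k • ξ) φ) atTop (𝓝 φ) := by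
  have hin : Tendsto (fun k => ⟪φ, displacement (t k • ξ) φ⟫_ℂ) atTop (𝓝 ⟪φ, φ⟫_ℂ) := by
    simp only [L2.inner_def]
    have hint : Integrable (fun x => ‖φ x‖ ^ 2) volume := (Lp.memLp φ).integrable_norm_pow (by simp)
    have hform : ∀ k, (fun x => ⟪φ x, displacement (t k • ξ) φ x⟫_ℂ) =ᵐ[volume] fun x =>
        ⟪φ x, Complex.exp (Complex.I * ((-(t k * ∑ j, ξ (1, j) * x j) : ℝ) : ℂ)) * φ x⟫_ℂ := by
      intro k
      have hs : shift (t k • ξ) = 0 := by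
        funext j
        simp [shift, hξ]
      filter_upwards [displacement_coeFn (t k • ξ) φ] with x hx
      rw [hx, hs, add_zero]
      congr 5
      simp [phase, hξ, Finset.mul_sum, mul_assoc]
    refine tendsto_integral_of_dominated_convergence (fun x => ‖φ x‖ ^ 2)
      (fun k => (Lp.aestronglyMeasurable φ).inner (Lp.aestronglyMeasurable _)) hint ?_ ?_
    · intro k
      filter_upwards [hform k] with x hx
      rw [hx]
      refine (norm_inner_le_norm _ _).trans ?_
      rw [norm_mul, mul_comm Complex.I, Complex.norm_exp_ofReal_mul_I, one_mul, sq]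
    · filter_upwards [ae_all_iff.2 hform] with x hx
      simp only [hx]
      have h0 : Tendsto (fun k => Complex.exp
          (Complex.I * ((-(t k * ∑ j, ξ (1, j) * x j) : ℝ) : ℂ)) * φ x) atTop (𝓝 (φ x)) := by
        have h1 : Continuous fun r : ℝ => Complex.exp
          (Complex.I * ((-(r * ∑ j, ξ (1, j) * x j) : ℝ) : ℂ)) * φ x := by fun_prop
        simpa [Function.comp_def] using (h1.tendsto 0).comp ht
      exact tendsto_const_nhds.inner h0
  rw [tendsto_iff_norm_sub_tendsto_zero]
  have hsq : Tendsto (fun k => ‖displacement (t k • ξ) φ - φ‖ ^ 2) atTop (𝓝 0) := by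
    have h2 : Tendsto (fun k => 2 * ‖φ‖ ^ 2 - 2 * (⟪φ, displacement (t k • ξ) φ⟫_ℂ).re) atTop
        (𝓝 (2 * ‖φ‖ ^ 2 - 2 * (⟪φ, φ⟫_ℂ).re)) :=
      (((Complex.continuous_re.tendsto _).comp hin).const_mul 2).const_sub _
    have h3 : (⟪φ, φ⟫_ℂ).re = ‖φ‖ ^ 2 := (norm_sq_eq_re_inner (𝕜 := ℂ) φ).symm
    rw [h3, sub_self] at h2
    refine h2.congr fun k => ?_
    rw [norm_sub_rev, norm_sub_sq (𝕜 := ℂ), norm_displacement_apply]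
    simp only [RCLike.re_to_complex]
    ring
  have h4 := hsq.sqrt
  simpa [Real.sqrt_sq (norm_nonneg _)] using h4

/-- Here `D` is a pure translation, and translations act continuously on `L²`. -/
theorem tendsto_displacement_of_momentum_eq_zero {ξ : PhaseSpace n} (hξ : ∀ j, ξ (1, j) = 0)
    {t : ℕ → ℝ} (ht : Tendsto t atTop (𝓝 0)) (φ : ModeSpace n) :
    Tendsto (fun k => displacement (t k • ξ) φ) atTop (𝓝 φ) := by
  let F : C(ℝ, C(Fin n → ℝ, Fin n → ℝ)) :=
    ContinuousMap.curry ⟨fun p : ℝ × (Fin n → ℝ) => p.2 + p.1 • shift ξ, by fun_prop⟩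
  have hF : ∀ r, MeasurePreserving (F r) volume volume := fun r =>
    measurePreserving_add_right volume (r • shift ξ)
  have hD : ∀ r : ℝ, displacement (r • ξ) φ = Lp.compMeasurePreserving (F r) (hF r) φ := by
    intro r
    refine Lp.ext ?_
    filter_upwards [displacement_coeFn (r • ξ) φ, Lp.coeFn_compMeasurePreserving φ (hF r)]
      with x h1 h2
    have hp : phase (r • ξ) x = 0 := by simp [phase, hξ]
    have hs : shift (r • ξ) = r • shift ξ := rfl
    rw [h1, h2, hp, hs]
    simp [F]
  have h := Tendsto.compMeasurePreservingLp (f := fun _ : ℕ => φ) (p := 2) tendsto_const_nhds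
    ((F.continuous.tendsto 0).comp ht) (fun k => hF (t k)) (hF 0) (by simp)
  rw [← hD, zero_smul, displacement_zero] at h
  exact h.congr fun k => (hD (t k)).symm

/-- Displacements along a nonzero direction converge weakly to zero. -/
theorem tendsto_inner_displacement_zero {η : PhaseSpace n} (hη : η ≠ 0) (φ : ModeSpace n) :
    Tendsto (fun k : ℕ => ⟪φ, displacement ((k : ℝ) • η) φ⟫_ℂ) atTop (𝓝 0) := by
  obtain ⟨ξ, hξ, hne⟩ := exists_dotProduct_Ω_ne_zero hη
  set θ := ξ ⬝ᵥ (Ω n).mulVec η with hθ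
  -- This makes `k · t k · θ = π`: conjugation by `D(t k ξ)` flips the sign of `D(kη)`, although
  -- `D(t k ξ) φ` tends to `φ`. The expectation value is thus close to its own negative.
  set t : ℕ → ℝ := fun k => Real.pi / (k * θ) with ht
  have ht0 : Tendsto t atTop (𝓝 0) := by
    have := (tendsto_const_div_atTop_nhds_zero_nat (Real.pi / θ))
    refine this.congr fun k => ?_
    rw [ht, div_div, mul_comm θ]
  have hlim : Tendsto (fun k => displacement (t k • ξ) φ) atTop (𝓝 φ) :=
    hξ.elim (fun h => tendsto_displacement_of_shift_eq_zero h ht0 φ)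
      fun h => tendsto_displacement_of_momentum_eq_zero h ht0 φ
  -- At `k = 0` the division convention gives `t 0 = 0`, and there is no sign flip.
  have hbound : ∀ k : ℕ, 1 ≤ k → ‖⟪φ, displacement ((k : ℝ) • η) φ⟫_ℂ‖
      ≤ ‖displacement (t k • ξ) φ - φ‖ * ‖φ‖ := by
    intro k hk
    set D := displacement ((k : ℝ) • η) with hD
    set φ' := displacement (t k • ξ) φ with hφ'
    have hk' : (k : ℝ) ≠ 0 := by positivity
    have h1 : ⟪φ', D φ'⟫_ℂ = -⟪φ, D φ⟫_ℂ := by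
      rw [hφ', hD, inner_displacement_conj, Matrix.mulVec_smul, dotProduct_smul, smul_dotProduct,
        ← hθ]
      have h2 : (k : ℝ) • t k • θ = Real.pi := by
        rw [ht, smul_eq_mul, smul_eq_mul]
        field_simp
      rw [h2, mul_comm Complex.I, Complex.exp_pi_mul_I, neg_one_mul]
    have h3 : 2 * ⟪φ, D φ⟫_ℂ = -(⟪φ' - φ, D φ⟫_ℂ + ⟪φ', D (φ' - φ)⟫_ℂ) := by
      rw [map_sub, inner_sub_left, inner_sub_right, h1]
      ring
    have h4 : 2 * ‖⟪φ, D φ⟫_ℂ‖ ≤ 2 * (‖φ' - φ‖ * ‖φ‖) := by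
      calc 2 * ‖⟪φ, D φ⟫_ℂ‖ = ‖2 * ⟪φ, D φ⟫_ℂ‖ := by rw [norm_mul]; simp
        _ ≤ ‖⟪φ' - φ, D φ⟫_ℂ‖ + ‖⟪φ', D (φ' - φ)⟫_ℂ‖ := by
            rw [h3, norm_neg]
            exact norm_add_le _ _
        _ ≤ ‖φ' - φ‖ * ‖D φ‖ + ‖φ'‖ * ‖D (φ' - φ)‖ :=
            add_le_add (norm_inner_le_norm _ _) (norm_inner_le_norm _ _)
        _ = 2 * (‖φ' - φ‖ * ‖φ‖) := by
            rw [hD, norm_displacement_apply, norm_displacement_apply, hφ', norm_displacement_apply]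
            ring
    linarith
  refine squeeze_zero_norm' ((eventually_ge_atTop 1).mono hbound) ?_
  simpa using ((tendsto_iff_norm_sub_tendsto_zero.1 hlim).mul_const ‖φ‖)

/-- A Riemann-Lebesgue statement along rays, free of moment or energy bounds; it therefore applies
to any ancilla state. -/
theorem tendsto_charFn_zero (T : traceClass (ModeSpace n)) {η : PhaseSpace n} (hη : η ≠ 0) :
    Tendsto (fun k : ℕ => charFn T ((k : ℝ) • η)) atTop (𝓝 0) :=
  tendsto_trace_comp_zero T.2 (fun _ => norm_displacement_le _)
    (tendsto_inner_displacement_zero hη)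

instance : Nontrivial (ModeSpace n) := by
  let f : ModeSpace n := indicatorConstLp 2 (measurableSet_ball (x := (0 : Fin n → ℝ)) (ε := 1))
    measure_ball_lt_top.ne 1
  refine ⟨f, 0, fun h => ?_⟩
  have h1 : ‖f‖ = 0 := by rw [h, norm_zero]
  rw [norm_indicatorConstLp (by simp) (by simp)] at h1
  have h2 : 0 < volume.real (Metric.ball (0 : Fin n → ℝ) 1) :=
    ENNReal.toReal_pos (Metric.measure_ball_pos volume _ one_pos).ne' measure_ball_lt_top.ne
  have := Real.rpow_pos_of_pos h2 (1 / (2 : ENNReal).toReal)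
  simp at h1
  simp at this
  linarith

/-- No displacement has vanishing expectation value in all pure states. -/
theorem exists_inner_displacement_ne_zero (ξ : PhaseSpace n) :
    ∃ ψ : ModeSpace n, ‖ψ‖ = 1 ∧ ⟪ψ, displacement ξ ψ⟫_ℂ ≠ 0 := by
  by_contra! h
  have h0 : ∀ ψ : ModeSpace n, ⟪ψ, displacement ξ ψ⟫_ℂ = 0 := by
    intro ψ
    by_cases hψ : ψ = 0
    · simp [hψ]
    have hn : (‖ψ‖ : ℂ) ≠ 0 := by simpa using hψ
    have := h ((‖ψ‖⁻¹ : ℂ) • ψ) (by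
      rw [norm_smul, norm_inv, Complex.norm_real, norm_norm]
      exact inv_mul_cancel₀ (norm_ne_zero_iff.2 hψ))
    rw [map_smul, inner_smul_left, inner_smul_right] at this
    simpa [hψ] using this
  -- By complex polarization, an operator with vanishing quadratic form is zero; an isometry of a
  -- nontrivial space is not.
  have h1 : (displacement ξ : ModeSpace n →ₗ[ℂ] ModeSpace n) = 0 := by
    rw [← inner_map_self_eq_zero]
    intro ψ
    rw [← inner_conj_symm, coe_coe, h0, map_zero]
  obtain ⟨ψ, hψ⟩ := exists_ne (0 : ModeSpace n)
  have h2 : displacement ξ ψ = 0 := congrArg (fun f : ModeSpace n →ₗ[ℂ] ModeSpace n => f ψ) h1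
  have := norm_displacement_apply ξ ψ
  rw [h2, norm_zero] at this
  exact hψ (norm_eq_zero.1 this.symm)

end Displacement

/-! ### The binary displacement channel against Gaussian dilations. -/

section Channels

open ContinuousLinearMap Filter Topology

variable {n : ℕ}

/-! ### The binary displacement channel is linear bosonic -/

theorem trace_displaced_comp (s : PhaseSpace n) (T : traceClass (ModeSpace n)) (ξ : PhaseSpace n) :
    trace ((displacement s ∘L (T : ModeSpace n →L[ℂ] ModeSpace n) ∘L displacement (-s)) ∘L
        displacement ξ)
      = Complex.exp (Complex.I * ((s ⬝ᵥ (Ω n).mulVec ξ : ℝ) : ℂ)) * charFn T ξ := by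
  rw [← star_displacement, trace_conj_comp (displacement_mem_unitary s) T.2, star_displacement,
    displacement_conj, comp_smul, trace_smul, charFn]

theorem charFn_binaryDisplacement (s : PhaseSpace n) (T : traceClass (ModeSpace n))
    (ξ : PhaseSpace n) :
    charFn (binaryDisplacement s T) ξ
      = charFn T ξ * Complex.cos ((s ⬝ᵥ (Ω n).mulVec ξ : ℝ) : ℂ) := by
  have h1 := trace_displaced_comp s T ξ
  have h2 := trace_displaced_comp (-s) T ξ
  have m1 := displaced_mem_traceClass s T.2
  have m2 := displaced_mem_traceClass (-s) T.2
  rw [neg_neg] at h2 m2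
  have h3 : charFn (binaryDisplacement s T) ξ = trace
      (((1 / 2 : ℂ) • (displacement (-s) ∘L (T : ModeSpace n →L[ℂ] ModeSpace n) ∘L displacement s)
        + (1 / 2 : ℂ) • (displacement s ∘L (T : ModeSpace n →L[ℂ] ModeSpace n) ∘L
          displacement (-s))) ∘L displacement ξ) := rfl
  rw [h3, trace_add_comp (Submodule.smul_mem _ _ m2) (Submodule.smul_mem _ _ m1), smul_comp,
    smul_comp, trace_smul, trace_smul, h1, h2, Complex.cos, neg_dotProduct]
  push_cast
  rw [mul_neg, mul_comm Complex.I, neg_mul]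
  ring

/-- Moving the outer displacement onto the left vector turns each half into the form of `T`
evaluated on a displaced family of vectors. -/
theorem isCompletelyPositive_binaryDisplacement (s : PhaseSpace n) :
    IsCompletelyPositive (binaryDisplacement s) := by
  intro k T hT v
  have key : ∀ (r : PhaseSpace n) (i j : Fin k),
      ⟪v i, displacement (-r) ((T i j : ModeSpace n →L[ℂ] ModeSpace n) (displacement r (v j)))⟫_ℂ
        = ⟪displacement r (v i),
          (T i j : ModeSpace n →L[ℂ] ModeSpace n) (displacement r (v j))⟫_ℂ := fun r i j => by
    rw [← star_displacement, star_eq_adjoint, adjoint_inner_right]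
  have hform : ∀ i j, ⟪v i, (binaryDisplacement s (T i j) : ModeSpace n →L[ℂ] ModeSpace n) (v j)⟫_ℂ
      = (1 / 2 : ℂ) * ⟪displacement s (v i),
          (T i j : ModeSpace n →L[ℂ] ModeSpace n) (displacement s (v j))⟫_ℂ
        + (1 / 2 : ℂ) * ⟪displacement (-s) (v i),
          (T i j : ModeSpace n →L[ℂ] ModeSpace n) (displacement (-s) (v j))⟫_ℂ := by
    intro i j
    rw [← key s, ← key (-s), neg_neg, ← inner_smul_right, ← inner_smul_right, ← inner_add_right]
    rfl
  simp only [hform, Finset.sum_add_distrib, ← Finset.mul_sum]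
  have h2 : (0 : ℂ) ≤ 1 / 2 := by
    rw [one_div, ← Complex.ofReal_ofNat, ← Complex.ofReal_inv]
    exact Complex.zero_le_real.2 (by norm_num)
  exact add_nonneg (mul_nonneg h2 (hT fun i => displacement s (v i)))
    (mul_nonneg h2 (hT fun i => displacement (-s) (v i)))

theorem charFn_zero (T : traceClass (ModeSpace n)) :
    charFn T 0 = trace (T : ModeSpace n →L[ℂ] ModeSpace n) := by
  rw [charFn, displacement_zero]
  rfl

theorem isTracePreserving_binaryDisplacement (s : PhaseSpace n) :
    IsTracePreserving (binaryDisplacement s) := fun T => by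
  rw [← charFn_zero, ← charFn_zero, charFn_binaryDisplacement]
  simp

theorem isLinearBosonicChannel_binaryDisplacement (s : PhaseSpace n) :
    IsLinearBosonicChannel (binaryDisplacement s) :=
  ⟨⟨isCompletelyPositive_binaryDisplacement s, isTracePreserving_binaryDisplacement s⟩, 1,
    fun ξ => Complex.cos ((s ⬝ᵥ (Ω n).mulVec ξ : ℝ) : ℂ), fun T ξ => by
      rw [charFn_binaryDisplacement, Matrix.one_mulVec]⟩

/-! ### Characteristic functions of Gaussian dilatable maps -/

/-- The pure state of a unit vector. -/
noncomputable def pureState (ψ : ModeSpace n) : traceClass (ModeSpace n) :=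
  ⟨InnerProductSpace.rankOne ℂ ψ ψ, Submodule.subset_span (isPositiveFiniteTrace_rankOne ψ)⟩

theorem charFn_pureState (ψ : ModeSpace n) (ξ : PhaseSpace n) :
    charFn (pureState ψ) ξ = ⟪ψ, displacement ξ ψ⟫_ℂ :=
  trace_rankOne_comp ψ _

theorem isDensityOperator_pureState {ψ : ModeSpace n} (hψ : ‖ψ‖ = 1) :
    IsDensityOperator (pureState ψ) := by
  refine ⟨InnerProductSpace.isPositive_rankOne_self ψ, ?_⟩
  rw [← charFn_zero, charFn_pureState, displacement_zero, one_apply_eq_self,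
    inner_self_eq_norm_sq_to_K, hψ]
  simp

/-- Conjugating a joint displacement of the first system by a Gaussian unitary gives a joint
displacement, up to a phase. -/
theorem IsGaussianUnitary.exists_conj {m : ℕ}
    {U : HilbertTensor (ModeSpace n) (ModeSpace m) →L[ℂ]
      HilbertTensor (ModeSpace n) (ModeSpace m)} (hU : IsGaussianUnitary U) :
    U ∈ unitary (HilbertTensor (ModeSpace n) (ModeSpace m) →L[ℂ]
        HilbertTensor (ModeSpace n) (ModeSpace m)) ∧
      ∃ (X : PhaseSpace n →ₗ[ℝ] PhaseSpace n) (Y : PhaseSpace n →ₗ[ℝ] PhaseSpace m)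
        (θ : PhaseSpace n → ℝ), ∀ ξ,
        star U ∘L opTensor (displacement ξ) 1 ∘L U = Complex.exp (Complex.I * (θ ξ : ℂ)) •
          opTensor (displacement (X ξ)) (displacement (Y ξ)) := by
  obtain ⟨s, t, V, ⟨hV, S, -, hS⟩, rfl⟩ := hU
  have hstar : star (opTensor (displacement s) (displacement t))
      = opTensor (displacement (-s)) (displacement (-t)) := by
    rw [star_eq_adjoint, adjoint_opTensor, ← star_eq_adjoint, ← star_eq_adjoint,
      star_displacement, star_displacement]
  have hneg : ∀ {k : ℕ} (r : PhaseSpace k), displacement (-r) ∘L displacement r = 1 := fun r => by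
    simpa using displacement_comp_neg (-r)
  have hD : opTensor (displacement s) (displacement t) ∈ unitary _ := by
    rw [Unitary.mem_iff, hstar, mul_def, mul_def, opTensor_comp, opTensor_comp, hneg, hneg,
      displacement_comp_neg, displacement_comp_neg, opTensor_one]
    exact ⟨rfl, rfl⟩
  refine ⟨mul_mem hD hV, ?_⟩
  let E : PhaseSpace n →ₗ[ℝ] JointPhaseSpace n m :=
    { toFun := fun ξ => Sum.elim ξ 0
      map_add' := fun ξ η => by ext (i | i) <;> simp
      map_smul' := fun a ξ => by ext (i | i) <;> simp }
  have hE : ∀ ξ, jointDisplacement (E ξ) = opTensor (displacement ξ) (1 : ModeSpace m →L[ℂ] _) :=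
    fun ξ => by rw [← displacement_zero]; rfl
  -- `X` and `Y` are the two blocks of `S` acting on `ξ ⊕ 0`. The phase comes from `D(s)` alone,
  -- since `D(t)` cancels against the identity on the ancilla.
  refine ⟨LinearMap.funLeft ℝ ℝ Sum.inl ∘ₗ S.mulVecLin ∘ₗ E,
    LinearMap.funLeft ℝ ℝ Sum.inr ∘ₗ S.mulVecLin ∘ₗ E, fun ξ => s ⬝ᵥ (Ω n).mulVec ξ, fun ξ => ?_⟩
  have h1 : star (opTensor (displacement s) (displacement t)) ∘L
      opTensor (displacement ξ) 1 ∘L opTensor (displacement s) (displacement t)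
      = Complex.exp (Complex.I * ((s ⬝ᵥ (Ω n).mulVec ξ : ℝ) : ℂ)) • jointDisplacement (E ξ) := by
    have h2 : (displacement (-t) ∘L 1 ∘L displacement t) = 1 := hneg t
    rw [hstar, opTensor_comp, opTensor_comp, displacement_conj, h2, opTensor_smul_left, hE]
  have h3 : star (opTensor (displacement s) (displacement t) ∘L V) ∘L
      opTensor (displacement ξ) 1 ∘L opTensor (displacement s) (displacement t) ∘L V
      = star V ∘L (star (opTensor (displacement s) (displacement t)) ∘L
        opTensor (displacement ξ) 1 ∘L opTensor (displacement s) (displacement t)) ∘L V := by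
    rw [star_eq_adjoint, adjoint_comp]
    rfl
  rw [h3, h1, smul_comp, comp_smul, hS]
  rfl

/-- The characteristic function of the output of a Gaussian dilatable map. -/
theorem IsGaussianDilatable.exists_charFn_eq
    {Φ : traceClass (ModeSpace n) →ₗ[ℂ] traceClass (ModeSpace n)} (hΦ : IsGaussianDilatable Φ) :
    ∃ (m : ℕ) (σ : traceClass (ModeSpace m)) (X : PhaseSpace n →ₗ[ℝ] PhaseSpace n)
      (Y : PhaseSpace n →ₗ[ℝ] PhaseSpace m) (θ : PhaseSpace n → ℝ), IsDensityOperator σ ∧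
      ∀ ρ, IsDensityOperator ρ → ∀ ξ, charFn (Φ ρ) ξ
        = Complex.exp (Complex.I * (θ ξ : ℂ)) * (charFn ρ (X ξ) * charFn σ (Y ξ)) := by
  obtain ⟨m, σ, U, hσ, hU, h⟩ := hΦ
  obtain ⟨hunit, X, Y, θ, hXY⟩ := hU.exists_conj
  refine ⟨m, σ, X, Y, θ, hσ, fun ρ hρ ξ => ?_⟩
  -- The partial trace is tested on `B = D(ξ)`, and `U` is moved onto `D(ξ) ⊗ 1`.
  rw [charFn, h ρ hρ, trace_conj_comp hunit (opTensor_mem_traceClass ρ.2 σ.2), hXY, comp_smul,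
    trace_smul, trace_opTensor_comp ρ.2 σ.2]
  rfl

/-! ### The binary displacement channel is not Gaussian dilatable -/

theorem not_isGaussianDilatable_binaryDisplacement {s : PhaseSpace n} (hs : s ≠ 0) :
    ¬ IsGaussianDilatable (binaryDisplacement s) := by
  intro hdil
  obtain ⟨m, σ, X, Y, θ, hσ, h⟩ := hdil.exists_charFn_eq
  have hpure : ∀ (ψ : ModeSpace n), ‖ψ‖ = 1 → ∀ ξ,
      ⟪ψ, displacement ξ ψ⟫_ℂ * Complex.cos ((s ⬝ᵥ (Ω n).mulVec ξ : ℝ) : ℂ)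
        = Complex.exp (Complex.I * (θ ξ : ℂ)) *
          (⟪ψ, displacement (X ξ) ψ⟫_ℂ * charFn σ (Y ξ)) := by
    intro ψ hψ ξ
    have := h _ (isDensityOperator_pureState hψ) ξ
    rwa [charFn_binaryDisplacement, charFn_pureState, charFn_pureState] at this
  have hX : ∀ ξ, Complex.cos ((s ⬝ᵥ (Ω n).mulVec ξ : ℝ) : ℂ) ≠ 0 → X ξ = ξ := by
    intro ξ hcos
    by_contra hne
    -- With this `ζ`, replacing `ψ` by `D(ζ) ψ` multiplies the two sides of `hpure` by opposite
    -- phases, so both sides vanish.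
    obtain ⟨ζ, hζ⟩ := exists_dotProduct_Ω_eq (sub_ne_zero.2 hne) Real.pi
    obtain ⟨ψ, hψ, h0⟩ := exists_inner_displacement_ne_zero ξ
    have h1 := hpure ψ hψ ξ
    have h2 := hpure (displacement ζ ψ) (by rw [norm_displacement_apply, hψ]) ξ
    rw [inner_displacement_conj, inner_displacement_conj] at h2
    have h3 : Complex.exp (Complex.I * ((ζ ⬝ᵥ (Ω n).mulVec (X ξ) : ℝ) : ℂ))
        = -Complex.exp (Complex.I * ((ζ ⬝ᵥ (Ω n).mulVec ξ : ℝ) : ℂ)) := by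
      have : ζ ⬝ᵥ (Ω n).mulVec (X ξ) = ζ ⬝ᵥ (Ω n).mulVec ξ + Real.pi := by
        rw [← hζ, Matrix.mulVec_sub, dotProduct_sub]
        ring
      rw [this, Complex.ofReal_add, mul_add, Complex.exp_add, mul_comm Complex.I (Real.pi : ℂ),
        Complex.exp_pi_mul_I, mul_neg_one]
    rw [h3] at h2
    have h4 : Complex.exp (Complex.I * ((ζ ⬝ᵥ (Ω n).mulVec ξ : ℝ) : ℂ)) *
        (⟪ψ, displacement ξ ψ⟫_ℂ * Complex.cos ((s ⬝ᵥ (Ω n).mulVec ξ : ℝ) : ℂ)) = 0 := by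
      linear_combination (1 / 2) * h2 + (1 / 2) *
        Complex.exp (Complex.I * ((ζ ⬝ᵥ (Ω n).mulVec ξ : ℝ) : ℂ)) * h1
    exact mul_ne_zero (Complex.exp_ne_zero _) (mul_ne_zero h0 hcos) h4
  have hσnorm : ∀ ξ, Complex.cos ((s ⬝ᵥ (Ω n).mulVec ξ : ℝ) : ℂ) ≠ 0 →
      ‖charFn σ (Y ξ)‖ = ‖Complex.cos ((s ⬝ᵥ (Ω n).mulVec ξ : ℝ) : ℂ)‖ := by
    intro ξ hcos
    obtain ⟨ψ, hψ, h0⟩ := exists_inner_displacement_ne_zero ξ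
    have h1 := congrArg norm (hpure ψ hψ ξ)
    rw [hX ξ hcos, norm_mul, norm_mul, norm_mul, Complex.norm_exp_I_mul_ofReal, one_mul] at h1
    exact (mul_left_cancel₀ (norm_ne_zero_iff.2 h0) h1).symm
  -- The minus sign compensates for swapping the arguments: the aim is `s·Ωξ = π`.
  obtain ⟨ξ, hξ⟩ := exists_dotProduct_Ω_eq hs (-Real.pi)
  rw [dotProduct_Ω_mulVec_swap, neg_inj] at hξ
  have hscale : ∀ a : ℝ, s ⬝ᵥ (Ω n).mulVec (a • ξ) = a * Real.pi := fun a => by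
    rw [Matrix.mulVec_smul, dotProduct_smul, hξ, smul_eq_mul]
  have hY : Y ξ = 0 := by
    by_contra hne
    have hlim := (tendsto_charFn_zero σ hne).norm
    have hone : ∀ k : ℕ, ‖charFn σ ((k : ℝ) • Y ξ)‖ = 1 := by
      intro k
      have hcos : ‖Complex.cos ((s ⬝ᵥ (Ω n).mulVec ((k : ℝ) • ξ) : ℝ) : ℂ)‖ = 1 := by
        rw [hscale, ← Complex.ofReal_cos, Complex.norm_real, Real.cos_nat_mul_pi, norm_pow]
        simp
      rw [← map_smul, hσnorm _ (norm_ne_zero_iff.1 (by rw [hcos]; exact one_ne_zero)), hcos]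
    simp only [hone, norm_zero] at hlim
    exact one_ne_zero (tendsto_nhds_unique tendsto_const_nhds hlim)
  -- At `ξ/2` the cosine vanishes and `hX` gives nothing, so `ψ` is chosen for the point `X(ξ/2)`
  -- itself.
  obtain ⟨ψ, hψ, h0⟩ := exists_inner_displacement_ne_zero (X ((1 / 2 : ℝ) • ξ))
  have hhalf := hpure ψ hψ ((1 / 2 : ℝ) • ξ)
  have hc : Complex.cos (((1 / 2 * Real.pi : ℝ)) : ℂ) = 0 := by
    rw [← Complex.ofReal_cos, one_div_mul_eq_div, Real.cos_pi_div_two, Complex.ofReal_zero]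
  rw [hscale, hc, mul_zero, map_smul Y, hY, smul_zero, charFn_zero, hσ.2, mul_one] at hhalf
  exact mul_ne_zero (Complex.exp_ne_zero _) h0 hhalf.symm

end Channels

end Bosonic

theorem corollary2 (n : ℕ) (s : Bosonic.PhaseSpace n) (hs : s ≠ 0) :
    Bosonic.IsLinearBosonicChannel (Bosonic.binaryDisplacement s) ∧
      ¬ Bosonic.IsGaussianDilatable (Bosonic.binaryDisplacement s) :=
  ⟨Bosonic.isLinearBosonicChannel_binaryDisplacement s,
    Bosonic.not_isGaussianDilatable_binaryDisplacement hs⟩
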